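/- All systems are finite-dimensional multi-qubit systems (possibly with zero qubits), with operators taken in the computational basis; $|X|$ is the dimension of a system $X$, and $XY$ denotes the composite of $X$ and $Y$. A pure state $|\psi\rangle$ of $n$ qubits is a stabilizer state if it is fixed by every element of an Abelian subgroup, with $2^n$ elements, of the $n$-qubit Pauli group (the tensor products of $I,X,Y,Z$ with phases $\pm1,\pm i$). $\mathrm{STAB}(X)$ is the convex hull of the density matrices $|\psi\rangle\langle\psi|$ of the pure stabilizer states of $X$. A channel $\mathcal{E}:A_0\to A_1$ (a completely positive trace preserving map) is a completely stabilizer preserving operation (CSPO) if $(\mathcal{E}\otimes\mathsf{id}_{R})(\rho)\in\mathrm{STAB}(A_1R)$ for every system $R$ and every $\rho\in\mathrm{STAB}(A_0R)$. Let $A=(A_0\to A_1)$ and $B=(B_0\to B_1)$ be pairs of systems, and let $\Theta$ be a linear map from the linear maps $L(A_0)\to L(A_1)$ to the linear maps $L(B_0)\to L(B_1)$, where $L(X)$ is the space of operators on $X$. For systems $R_0,R_1$ let $\mathbb{1}_R$ be the identity supermap on the linear maps $L(R_0)\to L(R_1)$; thus $\mathbb{1}_R\otimes\Theta$ takes linear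 maps $L(A_0R_0)\to L(A_1R_1)$ to linear maps $L(B_0R_0)\to L(B_1R_1)$. $\Theta$ is a superchannel if, for all $R_0,R_1$, $\mathbb{1}_R\otimes\Theta$ takes channels to channels. A superchannel $\Theta$ is completely CSPO preserving if, for all $R_0,R_1$, $(\mathbb{1}_R\otimes\Theta)[\mathcal{N}]$ is a CSPO for every CSPO $\mathcal{N}:A_0R_0\to A_1R_1$. The Choi matrix of a linear map $\mathcal{N}:L(X_0)\to L(X_1)$ is $J^{\mathcal{N}}=\sum_{i,j}|i\rangle\langle j|\otimes\mathcal{N}(|i\rangle\langle j|)$, on $X_0X_1$. The Choi matrix of $\Theta$ is $$\mathbf{J}^{\Theta}_{AB}=\sum_{a,a'}|a\rangle\langle a'|\otimes J^{\Theta[\mathcal{E}_{aa'}]},$$ where $a,a'$ run over the computational basis of $A_0A_1$ and $\mathcal{E}_{aa'}$ is the linear map with $J^{\mathcal{E}_{aa'}}=|a\rangle\langle a'|$. Equivalently, $J^{\Theta[\mathcal{N}]}=\mathrm{Tr}_{A}\big[\mathbf{J}^{\Theta}_{AB}\,((J^{\mathcal{N}})^{T}\otimes I_B)\big]$ for all $\mathcal{N}$.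 **Theorem.** Let $\Theta$ be a superchannel from $A$ to $B$. Then $\Theta$ is completely CSPO preserving if and only if $$\frac{1}{|A_1B_0|}\,\mathbf{J}^{\Theta}_{AB}\in\mathrm{STAB}(A_0A_1B_0B_1).$$ -/

import Mathlib

open scoped ComplexOrder

namespace Magic

/-- Operators on a multi-qubit system. A system is the finite type `Q` of its qubits, its
computational basis is the set of bit strings `Q → Fin 2`, and its dimension is `2 ^ |Q|`.
The composite of the systems `Q` and `R` is `Q ⊕ R`, with basis strings `Sum.elim q r`. -/
abbrev Op (Q : Type) : Type := Matrix (Q → Fin 2) (Q → Fin 2) ℂ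

/-- Linear maps from the operators on `Q` to the operators on `Q'`. -/
abbrev OpMap (Q Q' : Type) : Type := Op Q →ₗ[ℂ] Op Q'

/-- Supermaps from the dynamical system `A = (A₀ → A₁)` to `B = (B₀ → B₁)`. -/
abbrev SuperMap (A₀ A₁ B₀ B₁ : Type) : Type := OpMap A₀ A₁ →ₗ[ℂ] OpMap B₀ B₁

/-- The dimension of a system. -/
def dim (Q : Type) [Fintype Q] [DecidableEq Q] : ℕ := Fintype.card (Q → Fin 2)

section Stabilizer

/-- The single-qubit Pauli matrices `I, X, Y, Z`. -/
def pauli : Fin 4 → Matrix (Fin 2) (Fin 2) ℂ :=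
  ![!![1, 0; 0, 1], !![0, 1; 1, 0], !![0, -Complex.I; Complex.I, 0], !![1, 0; 0, -1]]

/-- The tensor product, over all qubits `q`, of the Pauli matrices `pauli (p q)`. -/
def pauliString {Q : Type} [Fintype Q] (p : Q → Fin 4) : Op Q :=
  Matrix.of fun s s' => ∏ q, pauli (p q) (s q) (s' q)

/-- The underlying set of the Pauli group: Pauli strings with a phase `1, i, -1, -i`. -/
def pauliGroup (Q : Type) [Fintype Q] : Set (Op Q) :=
  {M | ∃ (k : Fin 4) (p : Q → Fin 4), M = Complex.I ^ (k : ℕ) • pauliString p}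

/-- A unit vector `ψ` is a pure stabilizer state if it is fixed by every element of an Abelian
subgroup, with `2 ^ n` elements, of the `n`-qubit Pauli group. -/
def IsPureStabilizer {Q : Type} [Fintype Q] [DecidableEq Q] (ψ : (Q → Fin 2) → ℂ) : Prop :=
  star ψ ⬝ᵥ ψ = 1 ∧
    ∃ S : Subgroup (Op Q)ˣ,
      (∀ g ∈ S, (g : Op Q) ∈ pauliGroup Q) ∧
      (∀ g ∈ S, ∀ h ∈ S, g * h = h * g) ∧
      Nat.card S = 2 ^ Fintype.card Q ∧
      ∀ g ∈ S, (g : Op Q).mulVec ψ = ψ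

/-- Stabilizer states, as density matrices: the convex hull of the pure stabilizer states. -/
def STAB (Q : Type) [Fintype Q] [DecidableEq Q] : Set (Op Q) :=
  convexHull ℝ {ρ | ∃ ψ : (Q → Fin 2) → ℂ, IsPureStabilizer ψ ∧ ρ = Matrix.vecMulVec ψ (star ψ)}

end Stabilizer

section Composite

/-- The tensor product of operators. -/
def tensor {Q R : Type} (X : Op Q) (Y : Op R) : Op (Q ⊕ R) :=
  Matrix.of fun s s' => X (s ∘ Sum.inl) (s' ∘ Sum.inl) * Y (s ∘ Sum.inr) (s' ∘ Sum.inr)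

/-- The block `(1 ⊗ ⟨r|) X (1 ⊗ |r'⟩)` of an operator on a composite system. -/
def block {Q R : Type} (r r' : R → Fin 2) : Op (Q ⊕ R) →ₗ[ℂ] Op Q where
  toFun X := Matrix.of fun q q' => X (Sum.elim q r) (Sum.elim q' r')
  map_add' _ _ := rfl
  map_smul' _ _ := rfl

/-- The action `E ⊗ id_R` of a linear map on the first part of a composite system:
`E` is applied to every block. -/
def tensorId {Q Q' : Type} (R : Type) (E : OpMap Q Q') : OpMap (Q ⊕ R) (Q' ⊕ R) where
  toFun X := Matrix.of fun s s' =>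
    E (block (s ∘ Sum.inr) (s' ∘ Sum.inr) X) (s ∘ Sum.inl) (s' ∘ Sum.inl)
  map_add' X Y := by ext s s'; simp
  map_smul' c X := by ext s s'; simp

end Composite

section Channel

variable {Q Q' : Type} [Fintype Q] [DecidableEq Q] [Fintype Q'] [DecidableEq Q']

/-- Quantum channels: completely positive and trace preserving maps. -/
structure IsCPTP (E : OpMap Q Q') : Prop where
  completelyPositive : ∀ (R : Type) [Fintype R] [DecidableEq R] (X : Op (Q ⊕ R)),
    X.PosSemidef → (tensorId R E X).PosSemidef
  tracePreserving : ∀ X : Op Q, (E X).trace = X.trace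

/-- Completely stabilizer preserving operations. -/
structure IsCSPO (E : OpMap Q Q') : Prop where
  isCPTP : IsCPTP E
  mem_STAB : ∀ (R : Type) [Fintype R] [DecidableEq R] (ρ : Op (Q ⊕ R)),
    ρ ∈ STAB (Q ⊕ R) → tensorId R E ρ ∈ STAB (Q' ⊕ R)

end Channel

section Choi

/-- The Choi matrix `J = ∑ i j, |i⟩⟨j| ⊗ E(|i⟩⟨j|)` of a linear map, on the system `Q ⊕ Q'`;
it is the image of the unnormalized maximally entangled state under `id ⊗ E`. -/
def choi {Q Q' : Type} [DecidableEq Q] [Fintype Q] (E : OpMap Q Q') : Op (Q ⊕ Q') :=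
  Matrix.of fun s s' =>
    E (Matrix.single (s ∘ Sum.inl) (s' ∘ Sum.inl) 1) (s ∘ Sum.inr) (s' ∘ Sum.inr)

/-- The elementary map `X ↦ ⟨i|X|i'⟩ |j⟩⟨j'|`, where `a` is the string of `i` and `j`, and `a'`
that of `i'` and `j'`. Its Choi matrix is `|a⟩⟨a'|`. -/
def elementaryMap {A₀ A₁ : Type} [Fintype A₁] [DecidableEq A₁] (a a' : A₀ ⊕ A₁ → Fin 2) :
    OpMap A₀ A₁ where
  toFun X := X (a ∘ Sum.inl) (a' ∘ Sum.inl) •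
    Matrix.single (a ∘ Sum.inr) (a' ∘ Sum.inr) (1 : ℂ)
  map_add' X Y := by simp [add_smul]
  map_smul' c X := by simp [mul_smul]

/-- The Choi matrix of a supermap on the system `AB = (A₀ ⊕ A₁) ⊕ (B₀ ⊕ B₁)`: it is
`∑ a a', |a⟩⟨a'| ⊗ J(Θ[E a a'])` with `E a a'` the elementary maps. Equivalently, it is the
operator `J` on `AB` such that, for all `N`, the Choi matrix of `Θ[N]` is
`Tr_A [J ((choi N)ᵀ ⊗ 1_B)]`. -/
def superChoi {A₀ A₁ B₀ B₁ : Type} [Fintype A₁] [DecidableEq A₁] [Fintype B₀] [DecidableEq B₀]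
    (Θ : SuperMap A₀ A₁ B₀ B₁) : Op ((A₀ ⊕ A₁) ⊕ (B₀ ⊕ B₁)) :=
  Matrix.of fun s s' =>
    choi (Θ (elementaryMap (s ∘ Sum.inl) (s' ∘ Sum.inl))) (s ∘ Sum.inr) (s' ∘ Sum.inr)

end Choi

section Super

variable {A₀ A₁ B₀ B₁ R₀ R₁ : Type}

/-- For `N` on the dynamical system `AR`, the map `X ↦ ⟨t| N(X ⊗ |r⟩⟨r'|) |t'⟩` on `A`. In other
words `N` is the sum over `r, r', t, t'` of `slice N r r' t t'` tensored with the elementary map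
`Y ↦ ⟨r|Y|r'⟩ |t⟩⟨t'|` on `R`. -/
def slice [Fintype R₀] [DecidableEq R₀] (N : OpMap (A₀ ⊕ R₀) (A₁ ⊕ R₁))
    (r r' : R₀ → Fin 2) (t t' : R₁ → Fin 2) : OpMap A₀ A₁ where
  toFun X := block t t' (N (tensor X (Matrix.single r r' 1)))
  map_add' X Y := by
    rw [← map_add, ← map_add]; congr 2; ext s s'; simp [tensor, add_mul]
  map_smul' c X := by
    simp only [RingHom.id_apply]
    rw [← map_smul, ← map_smul]; congr 2; ext s s'; simp [tensor, mul_assoc]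

/-- The action `Θ ⊗ 1_R` of a supermap on the part `A` of a map `N` on the dynamical system `AR`:
`Θ` is applied to every slice. It is the linear extension of `N ⊗ M ↦ Θ[N] ⊗ M`. -/
def applyPart [Fintype R₀] [DecidableEq R₀] (Θ : SuperMap A₀ A₁ B₀ B₁)
    (N : OpMap (A₀ ⊕ R₀) (A₁ ⊕ R₁)) : OpMap (B₀ ⊕ R₀) (B₁ ⊕ R₁) where
  toFun Y := Matrix.of fun s s' => ∑ r : R₀ → Fin 2, ∑ r' : R₀ → Fin 2,
    Θ (slice N r r' (s ∘ Sum.inr) (s' ∘ Sum.inr)) (block r r' Y) (s ∘ Sum.inl) (s' ∘ Sum.inl)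
  map_add' X Y := by ext s s'; simp [Finset.sum_add_distrib]
  map_smul' c X := by ext s s'; simp [Finset.mul_sum]

variable [Fintype A₀] [DecidableEq A₀] [Fintype A₁] [DecidableEq A₁]
  [Fintype B₀] [DecidableEq B₀] [Fintype B₁] [DecidableEq B₁]

/-- Superchannels: supermaps that take channels to channels, also when they act on a part of a
channel (the system `R` may be trivial). -/
def IsSuperchannel (Θ : SuperMap A₀ A₁ B₀ B₁) : Prop :=
  ∀ (R₀ R₁ : Type) [Fintype R₀] [DecidableEq R₀] [Fintype R₁] [DecidableEq R₁]
    (N : OpMap (A₀ ⊕ R₀) (A₁ ⊕ R₁)), IsCPTP N → IsCPTP (applyPart Θ N)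

/-- Completely CSPO preserving supermaps: they take CSPOs to CSPOs, also when they act on a part
of a CSPO. -/
def IsCompletelyCSPOPreserving (Θ : SuperMap A₀ A₁ B₀ B₁) : Prop :=
  ∀ (R₀ R₁ : Type) [Fintype R₀] [DecidableEq R₀] [Fintype R₁] [DecidableEq R₁]
    (N : OpMap (A₀ ⊕ R₀) (A₁ ⊕ R₁)), IsCSPO N → IsCSPO (applyPart Θ N)

end Super

end Magic

/-! The two directions rest on two facts about Choi matrices: Θ applied to half of a swap has the
Choi matrix of Θ itself, up to relabelling (`superChoi_eq_choi_swap`), and applying Θ ⊗ 1 to a map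
contracts their Choi matrices over A (`choi_applyPart`).

If Θ is completely CSPO preserving, feed it the swap A₀A₁ → A₁A₀, a CSPO because it only relabels
qubits. The result is a CSPO, and a CSPO sends the maximally entangled stabilizer state to its
normalized Choi matrix (`IsCSPO.choi_mem_STAB`).

Conversely, the cone of unnormalized stabilizer states is closed under contraction
(`contractOp_mem_stabCone`). One contraction puts the Choi matrix of (Θ ⊗ 1)[N] in the cone;
another, with an input state, does the same for the output (`isCSPO_of_choi_mem_stabCone`). Trace
preservation, which holds because Θ is a superchannel, fixes the normalization.

Everything thus reduces to pure states: contracting two stabilizer vectors gives a stabilizer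
vector, possibly zero (`IsStabilizerVector.contractVec`). The group definition is awkward here, so
it is replaced by a dichotomy: each Pauli string fixes the vector up to a phase or has expectation
0. By Parseval, squared expectations of a unit vector sum to 2 ^ n, and each fixing string
contributes 1; hence 2 ^ n fixing strings exhaust the sum, which links the two definitions. -/

namespace Magic

/-! ### Single-qubit Pauli matrices -/

section Pauli

lemma sum_pauli_mul_star_pauli (i j k l : Fin 2) :
    ∑ p, pauli p i j * star (pauli p k l) = if i = k ∧ j = l then 2 else 0 := by
  fin_cases i <;> fin_cases j <;> fin_cases k <;> fin_cases l <;>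
    simp [pauli, Fin.sum_univ_four] <;> norm_num

lemma sum_star_pauli_mul_pauli (p q : Fin 4) :
    ∑ x : Fin 2 × Fin 2, star (pauli p x.1 x.2) * pauli q x.1 x.2 = if p = q then 2 else 0 := by
  fin_cases p <;> fin_cases q <;>
    simp [pauli, Fintype.sum_prod_type] <;> norm_num

/-- The sign by which a Pauli matrix changes under complex conjugation. -/
def conjSign (p : Fin 4) : ℕ := if p = 2 then 2 else 0

lemma star_pauli (p : Fin 4) (i j : Fin 2) :
    star (pauli p i j) = Complex.I ^ conjSign p * pauli p i j := by
  fin_cases p <;> fin_cases i <;> fin_cases j <;> simp [pauli, conjSign]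

lemma conjTranspose_pauli (p : Fin 4) : (pauli p).conjTranspose = pauli p := by
  ext i j
  fin_cases p <;> fin_cases i <;> fin_cases j <;> simp [pauli]

lemma pauli_mul_self (p : Fin 4) : pauli p * pauli p = 1 := by
  ext i j
  fin_cases p <;> fin_cases i <;> fin_cases j <;> simp [pauli, Matrix.mul_apply]

lemma exists_pauli_mul_eq (p q : Fin 4) :
    ∃ (k : ℕ) (r : Fin 4), pauli p * pauli q = Complex.I ^ k • pauli r := by
  have h : ∃ (k : Fin 4) (r : Fin 4), pauli p * pauli q = Complex.I ^ (k : ℕ) • pauli r := by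
    fin_cases p <;> fin_cases q <;>
      [use 0, 0; use 0, 1; use 0, 2; use 0, 3;
       use 0, 1; use 0, 0; use 1, 3; use 3, 2;
       use 0, 2; use 3, 3; use 0, 0; use 1, 1;
       use 0, 3; use 1, 2; use 3, 1; use 0, 0] <;>
      ext i j <;> fin_cases i <;> fin_cases j <;>
      simp [pauli, Complex.I_pow_three]
  obtain ⟨k, r, h⟩ := h
  exact ⟨k, r, h⟩

lemma exists_pauli_mul_comm (p q : Fin 4) :
    ∃ c : ℂ, pauli p * pauli q = c • (pauli q * pauli p) := by
  -- Distinct non-identity Paulis anticommute; all other pairs commute.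
  by_cases h : p = 0 ∨ q = 0 ∨ p = q
  · refine ⟨1, ?_⟩
    ext i j
    rcases h with rfl | rfl | rfl
    · fin_cases q <;> fin_cases i <;> fin_cases j <;> simp [pauli]
    · fin_cases p <;> fin_cases i <;> fin_cases j <;> simp [pauli]
    · simp
  · refine ⟨-1, ?_⟩
    ext i j
    fin_cases p <;> fin_cases q <;> simp at h <;> fin_cases i <;> fin_cases j <;> simp [pauli]

end Pauli

/-! ### Pauli strings: completeness, orthogonality, products -/

section PauliString

variable {Q R : Type} [Fintype Q] [Fintype R]

lemma pauliString_apply (p : Q → Fin 4) (s s' : Q → Fin 2) :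
    pauliString p s s' = ∏ q, pauli (p q) (s q) (s' q) := rfl

lemma star_pauliString (p : Q → Fin 4) (s s' : Q → Fin 2) :
    star (pauliString p s s') = Complex.I ^ (∑ q, conjSign (p q)) * pauliString p s s' := by
  simp only [pauliString_apply, star_prod, star_pauli, Finset.prod_mul_distrib,
    Finset.prod_pow_eq_pow_sum]

lemma conjTranspose_pauliString (p : Q → Fin 4) :
    (pauliString p).conjTranspose = pauliString p := by
  ext s s'
  simp only [Matrix.conjTranspose_apply, pauliString_apply, star_prod]
  refine Finset.prod_congr rfl fun q _ => ?_
  rw [← Matrix.conjTranspose_apply, conjTranspose_pauli]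

lemma pauliString_sum (p : Q ⊕ R → Fin 4) (s s' : Q ⊕ R → Fin 2) :
    pauliString p s s' = pauliString (p ∘ Sum.inl) (s ∘ Sum.inl) (s' ∘ Sum.inl) *
      pauliString (p ∘ Sum.inr) (s ∘ Sum.inr) (s' ∘ Sum.inr) := by
  simp [pauliString_apply, Fintype.prod_sum_type]

lemma mem_pauliGroup {M : Op Q} :
    M ∈ pauliGroup Q ↔ ∃ (k : ℕ) (p : Q → Fin 4), M = Complex.I ^ k • pauliString p := by
  constructor
  · rintro ⟨k, p, h⟩
    exact ⟨k, p, h⟩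
  · rintro ⟨k, p, h⟩
    exact ⟨⟨k % 4, Nat.mod_lt _ (by norm_num)⟩, p, by rw [h, Complex.I_pow_eq_pow_mod]⟩

variable [DecidableEq Q]

lemma sum_pauliString_mul_star (s s' t t' : Q → Fin 2) :
    ∑ p : Q → Fin 4, pauliString p s s' * star (pauliString p t t') =
      if s = t ∧ s' = t' then 2 ^ Fintype.card Q else 0 := by
  simp only [pauliString_apply, star_prod, ← Finset.prod_mul_distrib]
  rw [← Fintype.prod_sum (fun q p => pauli p (s q) (s' q) * star (pauli p (t q) (t' q)))]
  simp only [sum_pauli_mul_star_pauli, Finset.prod_ite_zero]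
  simp [funext_iff, forall_and]

/-- Completeness of the Pauli strings. -/
lemma sum_pauliString_pairing (M N : Op Q) :
    ∑ p : Q → Fin 4, (∑ s, ∑ s', pauliString p s s' * M s s') *
      (∑ s, ∑ s', star (pauliString p s s') * N s s') =
      2 ^ Fintype.card Q * ∑ s, ∑ s', M s s' * N s s' := by
  have h : ∀ p : Q → Fin 4, (∑ s, ∑ s', pauliString p s s' * M s s') *
      (∑ s, ∑ s', star (pauliString p s s') * N s s') =
      ∑ x : (Q → Fin 2) × (Q → Fin 2), ∑ y : (Q → Fin 2) × (Q → Fin 2),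
        (pauliString p x.1 x.2 * star (pauliString p y.1 y.2)) * (M x.1 x.2 * N y.1 y.2) := by
    intro p
    simp only [← Fintype.sum_prod_type', Finset.sum_mul_sum]
    exact Finset.sum_congr rfl fun x _ => by ring
  simp only [h]
  rw [Finset.sum_comm]
  simp only [Finset.sum_comm (s := (Finset.univ : Finset (Q → Fin 4))), ← Finset.sum_mul,
    sum_pauliString_mul_star, ← Prod.ext_iff]
  simp [← Fintype.sum_prod_type', Finset.mul_sum]

/-- Orthogonality of the Pauli strings. -/
lemma sum_star_pauliString_mul (p p' : Q → Fin 4) :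
    ∑ s, ∑ s', star (pauliString p s s') * pauliString p' s s' =
      if p = p' then 2 ^ Fintype.card Q else 0 := by
  -- One sum over strings of pairs, instead of two over strings, factorizes over the qubits.
  have h : ∑ x : Q → Fin 2 × Fin 2,
      ∏ q, star (pauli (p q) (x q).1 (x q).2) * pauli (p' q) (x q).1 (x q).2 =
      if p = p' then 2 ^ Fintype.card Q else 0 := by
    rw [← Fintype.prod_sum
      (fun q (x : Fin 2 × Fin 2) => star (pauli (p q) x.1 x.2) * pauli (p' q) x.1 x.2)]
    simp only [sum_star_pauli_mul_pauli, Finset.prod_ite_zero]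
    simp [funext_iff]
  rw [← h, ← Fintype.sum_prod_type']
  refine (Fintype.sum_equiv (Equiv.arrowProdEquivProdArrow Q (fun _ => Fin 2) (fun _ => Fin 2))
    _ _ fun x => ?_).symm
  simp [pauliString_apply, Finset.prod_mul_distrib, Equiv.arrowProdEquivProdArrow]

/-- The mixed-product rule for Kronecker products: the sum over intermediate bit strings factorizes
qubit by qubit. -/
lemma of_prod_mul_of_prod (M N : Q → Matrix (Fin 2) (Fin 2) ℂ) :
    (Matrix.of fun s s' => ∏ q, M q (s q) (s' q) : Op Q) *
      (Matrix.of fun s s' => ∏ q, N q (s q) (s' q) : Op Q) =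
      Matrix.of fun s s' => ∏ q, (M q * N q) (s q) (s' q) := by
  ext s s'
  simp only [Matrix.mul_apply, Matrix.of_apply, ← Finset.prod_mul_distrib]
  rw [← Fintype.prod_sum (fun q x => M q (s q) x * N q x (s' q))]

lemma pauliString_mul_self (p : Q → Fin 4) : pauliString p * pauliString p = 1 := by
  rw [pauliString, of_prod_mul_of_prod]
  ext s s'
  simp only [pauli_mul_self, Matrix.of_apply, Matrix.one_apply, Finset.prod_ite_zero]
  simp [funext_iff]

lemma exists_pauliString_mul_eq (p p' : Q → Fin 4) :
    ∃ (k : ℕ) (r : Q → Fin 4),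
      pauliString p * pauliString p' = Complex.I ^ k • pauliString r := by
  choose k r h using exists_pauli_mul_eq
  refine ⟨∑ q, k (p q) (p' q), fun q => r (p q) (p' q), ?_⟩
  rw [pauliString, pauliString, of_prod_mul_of_prod]
  ext s s'
  simp [h, pauliString_apply, Finset.prod_mul_distrib, Finset.prod_pow_eq_pow_sum]

lemma exists_pauliString_mul_comm (p p' : Q → Fin 4) :
    ∃ c : ℂ, pauliString p * pauliString p' = c • (pauliString p' * pauliString p) := by
  choose c h using exists_pauli_mul_comm
  refine ⟨∏ q, c (p q) (p' q), ?_⟩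
  simp only [pauliString, of_prod_mul_of_prod]
  ext s s'
  simp [h (p _), Finset.prod_mul_distrib]

/-- These are the entries of PᵀP. As P is Hermitian, Pᵀ is its entrywise conjugate, which is ±P, and
P² = 1. Contractions involve no conjugation, so it is the transpose that matters. -/
lemma sum_pauliString_mul_pauliString (p : Q → Fin 4) (t t' : Q → Fin 2) :
    ∑ s, pauliString p s t * pauliString p s t' =
      if t = t' then Complex.I ^ (∑ q, conjSign (p q)) else 0 := by
  have h := congrFun (congrFun (pauliString_mul_self p) t) t'
  nth_rewrite 1 [← conjTranspose_pauliString] at h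
  simp only [Matrix.mul_apply, Matrix.conjTranspose_apply, star_pauliString, mul_assoc,
    ← Finset.mul_sum, Matrix.one_apply] at h
  have h2 : (Complex.I ^ (∑ q, conjSign (p q))) * Complex.I ^ (∑ q, conjSign (p q)) = 1 := by
    rw [← Finset.prod_pow_eq_pow_sum, ← Finset.prod_mul_distrib]
    refine Finset.prod_eq_one fun q _ => ?_
    by_cases hq : p q = 2 <;> simp [conjSign, hq]
  calc _ = Complex.I ^ (∑ q, conjSign (p q)) * (Complex.I ^ (∑ q, conjSign (p q)) *
        ∑ s, pauliString p s t * pauliString p s t') := by rw [← mul_assoc, h2, one_mul]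
    _ = _ := by rw [h]; simp

end PauliString

/-! ### Stabilizer vectors and pure stabilizer states -/

section StabilizerVector

variable {Q R : Type} [Fintype Q] [DecidableEq Q] [Fintype R] [DecidableEq R]

/-- A vector such that every Pauli string either fixes it up to a phase `1, i, -1, -i` or has
expectation value `0` in it. The unit vectors of this kind are the pure stabilizer states. -/
def IsStabilizerVector (ψ : (Q → Fin 2) → ℂ) : Prop :=
  ∀ p : Q → Fin 4, (∃ k : ℕ, (pauliString p).mulVec ψ = Complex.I ^ k • ψ) ∨
    star ψ ⬝ᵥ (pauliString p).mulVec ψ = 0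

lemma expectation_eq_sum (M : Op Q) (ψ : (Q → Fin 2) → ℂ) :
    star ψ ⬝ᵥ M.mulVec ψ = ∑ s, ∑ s', M s s' * (star (ψ s) * ψ s') := by
  simp only [dotProduct, Matrix.mulVec, Finset.mul_sum, Pi.star_apply]
  exact Finset.sum_congr rfl fun s _ => Finset.sum_congr rfl fun s' _ => by ring

/-- Parseval's identity for the Pauli expectation values. -/
lemma sum_normSq_expectation {ψ : (Q → Fin 2) → ℂ} (hψ : star ψ ⬝ᵥ ψ = 1) :
    ∑ p : Q → Fin 4, Complex.normSq (star ψ ⬝ᵥ (pauliString p).mulVec ψ) =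
      2 ^ Fintype.card Q := by
  have h := sum_pauliString_pairing (fun s s' => star (ψ s) * ψ s')
    (fun s s' => star (star (ψ s) * ψ s'))
  have h1 : ∑ s, ∑ s', star (ψ s) * ψ s' * star (star (ψ s) * ψ s') = 1 := by
    calc _ = (star ψ ⬝ᵥ ψ) * (star ψ ⬝ᵥ ψ) := by
          simp only [dotProduct, Finset.sum_mul_sum, Pi.star_apply]
          refine Finset.sum_congr rfl fun s _ => Finset.sum_congr rfl fun s' _ => ?_
          simp only [star_mul', star_star]
          ring
      _ = 1 := by rw [hψ, one_mul]
  rw [h1, mul_one] at h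
  have h2 : ∀ p : Q → Fin 4, (∑ s, ∑ s', star (pauliString p s s') * star (star (ψ s) * ψ s')) =
      star (∑ s, ∑ s', pauliString p s s' * (star (ψ s) * ψ s')) := by
    intro p
    simp only [star_sum, star_mul']
  simp only [h2, ← expectation_eq_sum] at h
  have h3 : ((∑ p : Q → Fin 4, Complex.normSq (star ψ ⬝ᵥ (pauliString p).mulVec ψ) : ℝ) : ℂ) =
      ((2 ^ Fintype.card Q : ℝ) : ℂ) := by
    push_cast
    rw [← h]
    exact Finset.sum_congr rfl fun p _ => (Complex.mul_conj _).symm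
  exact_mod_cast h3

lemma normSq_I_pow (k : ℕ) : Complex.normSq (Complex.I ^ k) = 1 := by
  simp [map_pow]

open scoped Classical in
/-- A unit vector is a stabilizer vector if and only if `2 ^ n` Pauli strings fix it up to a phase. -/
lemma isStabilizerVector_card_criterion {ψ : (Q → Fin 2) → ℂ} (hψ : star ψ ⬝ᵥ ψ = 1) :
    (IsStabilizerVector ψ → (Finset.univ.filter fun p : Q → Fin 4 =>
      ∃ k : ℕ, (pauliString p).mulVec ψ = Complex.I ^ k • ψ).card = 2 ^ Fintype.card Q) ∧
    (2 ^ Fintype.card Q ≤ (Finset.univ.filter fun p : Q → Fin 4 =>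
      ∃ k : ℕ, (pauliString p).mulVec ψ = Complex.I ^ k • ψ).card → IsStabilizerVector ψ) := by
  set T := Finset.univ.filter fun p : Q → Fin 4 =>
      ∃ k : ℕ, (pauliString p).mulVec ψ = Complex.I ^ k • ψ with hT
  have hP := sum_normSq_expectation hψ
  rw [← Finset.sum_add_sum_compl T] at hP
  have h1 : ∑ p ∈ T, Complex.normSq (star ψ ⬝ᵥ (pauliString p).mulVec ψ) = T.card := by
    rw [Finset.card_eq_sum_ones, Nat.cast_sum]
    refine Finset.sum_congr rfl fun p hp => ?_
    obtain ⟨k, hk⟩ := (Finset.mem_filter.1 hp).2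
    rw [hk, dotProduct_smul, hψ, smul_eq_mul, mul_one, normSq_I_pow, Nat.cast_one]
  rw [h1] at hP
  constructor
  · intro h
    have h2 : ∑ p ∈ Tᶜ, Complex.normSq (star ψ ⬝ᵥ (pauliString p).mulVec ψ) = 0 := by
      refine Finset.sum_eq_zero fun p hp => ?_
      rcases h p with hk | h0
      · exact (Finset.mem_compl.1 hp (Finset.mem_filter.2 ⟨Finset.mem_univ _, hk⟩)).elim
      · rw [h0, map_zero]
    rw [h2, add_zero] at hP
    exact_mod_cast hP
  · intro h p
    by_cases hp : p ∈ T
    · exact Or.inl (Finset.mem_filter.1 hp).2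
    · have h3 := Finset.single_le_sum
        (f := fun p : Q → Fin 4 => Complex.normSq (star ψ ⬝ᵥ (pauliString p).mulVec ψ))
        (fun p _ => Complex.normSq_nonneg _) (Finset.mem_compl.2 hp)
      have h4 : (2 ^ Fintype.card Q : ℝ) ≤ T.card := by exact_mod_cast h
      refine Or.inr (Complex.normSq_eq_zero.1 (le_antisymm ?_ (Complex.normSq_nonneg _)))
      linarith

lemma ne_zero_of_unit {ψ : (Q → Fin 2) → ℂ} (hψ : star ψ ⬝ᵥ ψ = 1) : ψ ≠ 0 := by
  rintro rfl
  simp at hψ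

/-- The Pauli operators that fix a vector form a group. -/
def pauliStabilizer (ψ : (Q → Fin 2) → ℂ) : Subgroup (Op Q)ˣ where
  carrier := {g | (g : Op Q) ∈ pauliGroup Q ∧ (g : Op Q).mulVec ψ = ψ}
  mul_mem' := by
    rintro g h ⟨hg, hgψ⟩ ⟨hh, hhψ⟩
    refine ⟨?_, by rw [Units.val_mul, ← Matrix.mulVec_mulVec, hhψ, hgψ]⟩
    obtain ⟨k, p, hk⟩ := mem_pauliGroup.1 hg
    obtain ⟨l, q, hl⟩ := mem_pauliGroup.1 hh
    obtain ⟨m, r, hm⟩ := exists_pauliString_mul_eq p q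
    refine mem_pauliGroup.2 ⟨k + l + m, r, ?_⟩
    rw [Units.val_mul, hk, hl, smul_mul_smul_comm, hm, smul_smul, ← pow_add, ← pow_add]
  one_mem' := by
    refine ⟨mem_pauliGroup.2 ⟨0, fun _ => 0, ?_⟩, by simp⟩
    ext s s'
    simp only [Units.val_one, pow_zero, one_smul, pauliString_apply, pauli, Matrix.one_apply]
    rw [Finset.prod_congr rfl (g := fun q => if s q = s' q then (1 : ℂ) else 0)]
    · simp [Finset.prod_ite_zero, funext_iff]
    · intro q _
      generalize s q = a
      generalize s' q = b
      fin_cases a <;> fin_cases b <;> simp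
  inv_mem' := by
    rintro g ⟨hg, hgψ⟩
    constructor
    · obtain ⟨k, p, hk⟩ := mem_pauliGroup.1 hg
      -- The factor i ^ (3k) inverts i ^ k with a natural exponent.
      refine mem_pauliGroup.2 ⟨3 * k, p, ?_⟩
      refine Units.inv_eq_of_mul_eq_one_right ?_
      rw [hk, smul_mul_smul_comm, pauliString_mul_self, ← pow_add,
        show k + 3 * k = 4 * k by ring, pow_mul, Complex.I_pow_four, one_pow, one_smul]
    · nth_rewrite 1 [← hgψ]
      rw [Matrix.mulVec_mulVec, Units.inv_mul, Matrix.one_mulVec]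

lemma pauliString_smul_inj {p q : Q → Fin 4} {c d : ℂ} (hc : c ≠ 0)
    (h : c • pauliString p = d • pauliString q) : p = q := by
  by_contra hpq
  have h1 : ∑ s, ∑ s', star (pauliString p s s') * (c • pauliString p) s s' =
      ∑ s, ∑ s', star (pauliString p s s') * (d • pauliString q) s s' := by rw [h]
  simp only [Matrix.smul_apply, smul_eq_mul, mul_left_comm _ c, mul_left_comm _ d,
    ← Finset.mul_sum, sum_star_pauliString_mul, if_neg hpq, if_true, mul_zero] at h1
  exact mul_ne_zero hc (by positivity) h1

lemma mulVec_eq_of_smul_mulVec_eq {p : Q → Fin 4} {ψ : (Q → Fin 2) → ℂ} {k : ℕ}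
    (h : (Complex.I ^ k • pauliString p).mulVec ψ = ψ) :
    (pauliString p).mulVec ψ = Complex.I ^ (3 * k) • ψ := by
  nth_rewrite 2 [← h]
  rw [Matrix.smul_mulVec, smul_smul, ← pow_add, show 3 * k + k = 4 * k by ring, pow_mul,
    Complex.I_pow_four, one_pow, one_smul]

lemma smul_mulVec_eq_of_mulVec_eq {p : Q → Fin 4} {ψ : (Q → Fin 2) → ℂ} {k : ℕ}
    (h : (pauliString p).mulVec ψ = Complex.I ^ k • ψ) :
    (Complex.I ^ (3 * k) • pauliString p).mulVec ψ = ψ := by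
  rw [Matrix.smul_mulVec, h, smul_smul, ← pow_add, show 3 * k + k = 4 * k by ring, pow_mul,
    Complex.I_pow_four, one_pow, one_smul]

/-- A group of Pauli operators that fix a nonzero vector contains at most one phase of each
Pauli string. -/
lemma card_le_of_fixes {ψ : (Q → Fin 2) → ℂ} (hψ : ψ ≠ 0) (S : Subgroup (Op Q)ˣ)
    (hS : ∀ g ∈ S, (g : Op Q) ∈ pauliGroup Q) (hfix : ∀ g ∈ S, (g : Op Q).mulVec ψ = ψ) :
    Finite S ∧ Nat.card S ≤
      Nat.card {p : Q → Fin 4 // ∃ k : ℕ, (pauliString p).mulVec ψ = Complex.I ^ k • ψ} := by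
  choose k p h using fun g : S => mem_pauliGroup.1 (hS g g.2)
  have hp : ∀ g : S, ∃ k : ℕ, (pauliString (p g)).mulVec ψ = Complex.I ^ k • ψ := fun g =>
    ⟨_, mulVec_eq_of_smul_mulVec_eq ((h g) ▸ hfix g g.2)⟩
  have hinj : Function.Injective (fun g : S => (⟨p g, hp g⟩ :
      {p : Q → Fin 4 // ∃ k : ℕ, (pauliString p).mulVec ψ = Complex.I ^ k • ψ})) := by
    intro g g' hgg
    have hpp : p g = p g' := congrArg Subtype.val hgg
    have h1 := hfix g g.2
    have h2 := hfix g' g'.2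
    rw [h g, Matrix.smul_mulVec] at h1
    rw [h g', Matrix.smul_mulVec, ← hpp] at h2
    have h0 : (pauliString (p g)).mulVec ψ ≠ 0 := by
      intro h0
      rw [h0, smul_zero] at h1
      exact hψ h1.symm
    have hk := smul_left_injective ℂ h0 (h1.trans h2.symm)
    refine Subtype.ext (Units.ext ?_)
    rw [h g, h g', hpp]
    exact congrArg (· • _) hk
  exact ⟨Finite.of_injective _ hinj, Nat.card_le_card_of_injective _ hinj⟩

/-- Distinct elements of the stabilizing group have distinct underlying strings, so at least 2 ^ n
strings fix the vector and Parseval leaves nothing for the others. -/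
theorem IsPureStabilizer.isStabilizerVector {ψ : (Q → Fin 2) → ℂ} (h : IsPureStabilizer ψ) :
    IsStabilizerVector ψ := by
  classical
  obtain ⟨hψ, S, hS, -, hcard, hfix⟩ := h
  refine (isStabilizerVector_card_criterion hψ).2 ?_
  have h1 := (card_le_of_fixes (ne_zero_of_unit hψ) S hS hfix).2
  rwa [hcard, Nat.card_eq_fintype_card, Fintype.card_subtype] at h1

/-- The witness is the group of all Pauli operators fixing the vector, one for each string that
fixes it up to a phase. -/
theorem IsStabilizerVector.isPureStabilizer {ψ : (Q → Fin 2) → ℂ} (h : IsStabilizerVector ψ)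
    (hψ : star ψ ⬝ᵥ ψ = 1) : IsPureStabilizer ψ := by
  classical
  have hT := (isStabilizerVector_card_criterion hψ).1 h
  rw [← Fintype.card_subtype, ← Nat.card_eq_fintype_card] at hT
  refine ⟨hψ, pauliStabilizer ψ, fun g hg => hg.1, ?_, ?_, fun g hg => hg.2⟩
  · rintro g ⟨hg, hgψ⟩ g' ⟨hg', hgψ'⟩
    obtain ⟨k, p, hk⟩ := mem_pauliGroup.1 hg
    obtain ⟨l, q, hl⟩ := mem_pauliGroup.1 hg'
    -- The products in the two orders differ by a scalar; both fix a nonzero vector, so the scalar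
    -- is 1.
    obtain ⟨c, hc⟩ := exists_pauliString_mul_comm p q
    have h1 : (g : Op Q) * g' = c • ((g' : Op Q) * g) := by
      rw [hk, hl, smul_mul_smul_comm, smul_mul_smul_comm, hc, smul_comm c, mul_comm]
    have h2 := congrArg (fun M => M.mulVec ψ) h1
    simp only [Matrix.smul_mulVec, ← Matrix.mulVec_mulVec, hgψ, hgψ'] at h2
    have h3 : c = 1 :=
      smul_left_injective ℂ (ne_zero_of_unit hψ) (h2.symm.trans (one_smul ℂ ψ).symm)
    exact Units.ext (by rw [Units.val_mul, Units.val_mul, h1, h3, one_smul])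
  · obtain ⟨hfin, hle⟩ := card_le_of_fixes (ne_zero_of_unit hψ) (pauliStabilizer ψ)
      (fun g hg => hg.1) (fun g hg => hg.2)
    refine le_antisymm (hle.trans hT.le) (hT.symm.le.trans ?_)
    choose k hk using fun p : {p : Q → Fin 4 //
      ∃ k : ℕ, (pauliString p).mulVec ψ = Complex.I ^ k • ψ} => p.2
    have hI : ∀ p, Complex.I ^ (3 * k p) * Complex.I ^ k p = 1 := fun p => by
      rw [← pow_add, show 3 * k p + k p = 4 * k p by ring, pow_mul, Complex.I_pow_four, one_pow]
    refine Nat.card_le_card_of_injective (fun p => (⟨⟨Complex.I ^ (3 * k p) • pauliString p.1,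
      Complex.I ^ k p • pauliString p.1, ?_, ?_⟩, mem_pauliGroup.2 ⟨_, _, rfl⟩,
      smul_mulVec_eq_of_mulVec_eq (hk p)⟩ : pauliStabilizer ψ)) ?_
    · rw [smul_mul_smul_comm, pauliString_mul_self, hI, one_smul]
    · rw [smul_mul_smul_comm, pauliString_mul_self, mul_comm, hI, one_smul]
    · intro p q hpq
      have h1 := congrArg (fun g : pauliStabilizer ψ => ((g : (Op Q)ˣ) : Op Q)) hpq
      exact Subtype.ext (pauliString_smul_inj (pow_ne_zero _ Complex.I_ne_zero) h1)

lemma IsStabilizerVector.smul {ψ : (Q → Fin 2) → ℂ} (h : IsStabilizerVector ψ) (c : ℂ) :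
    IsStabilizerVector (c • ψ) := by
  intro p
  rcases h p with ⟨k, hk⟩ | h0
  · exact Or.inl ⟨k, by rw [Matrix.mulVec_smul, hk, smul_comm]⟩
  · exact Or.inr (by rw [Matrix.mulVec_smul, dotProduct_smul, star_smul, smul_dotProduct, h0,
      smul_zero, smul_zero])

lemma IsStabilizerVector.relabel {ψ : (Q → Fin 2) → ℂ} (h : IsStabilizerVector ψ) (e : Q ≃ R) :
    IsStabilizerVector fun s : R → Fin 2 => ψ (s ∘ e) := by
  intro p
  have hP : ∀ s s', pauliString p s s' = pauliString (p ∘ e) (s ∘ e) (s' ∘ e) := fun s s' =>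
    (Fintype.prod_equiv e _ _ fun q => rfl).symm
  have hM : (pauliString p).mulVec (fun s : R → Fin 2 => ψ (s ∘ e)) =
      fun s => (pauliString (p ∘ e)).mulVec ψ (s ∘ e) := by
    ext s
    simp only [Matrix.mulVec, dotProduct, hP]
    exact Fintype.sum_equiv (e.arrowCongr (Equiv.refl _)).symm _ _ fun s' => rfl
  rcases h (p ∘ e) with ⟨k, hk⟩ | h0
  · exact Or.inl ⟨k, by rw [hM, hk]; rfl⟩
  · refine Or.inr ?_
    rw [hM, ← h0]
    exact Fintype.sum_equiv (e.arrowCongr (Equiv.refl _)).symm _ _ fun s' => rfl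

end StabilizerVector

/-! ### Contraction of stabilizer vectors -/

section Contraction

variable {A B C : Type} [Fintype A] [DecidableEq A] [Fintype B] [DecidableEq B]
  [Fintype C] [DecidableEq C]

/-- The contraction of two vectors over the common part `A`. -/
def contractVec (ψ : (A ⊕ B → Fin 2) → ℂ) (φ : (A ⊕ C → Fin 2) → ℂ) : (B ⊕ C → Fin 2) → ℂ :=
  fun s => ∑ a, ψ (Sum.elim a (s ∘ Sum.inl)) * φ (Sum.elim a (s ∘ Sum.inr))

lemma sum_sumElim {M : Type*} [AddCommMonoid M] (f : (A ⊕ B → Fin 2) → M) :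
    ∑ s, f s = ∑ a, ∑ b, f (Sum.elim a b) := by
  rw [← Fintype.sum_prod_type']
  exact Fintype.sum_equiv (Equiv.sumArrowEquivProdArrow A B (Fin 2)) _ _ fun s => by
    simp [Equiv.sumArrowEquivProdArrow]

/-- The bilinear pairing turns P on both sides into PᵀP, which is a sign. -/
lemma sum_mulVec_mul_mulVec (α : A → Fin 4) (u v : (A → Fin 2) → ℂ) :
    ∑ a, (∑ a', pauliString α a a' * u a') * (∑ a', pauliString α a a' * v a') =
      Complex.I ^ (∑ q, conjSign (α q)) * ∑ a, u a * v a := by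
  have h : ∀ a, (∑ a', pauliString α a a' * u a') * (∑ a', pauliString α a a' * v a') =
      ∑ t, ∑ t', pauliString α a t * pauliString α a t' * (u t * v t') := by
    intro a
    rw [Finset.sum_mul_sum]
    exact Finset.sum_congr rfl fun t _ => Finset.sum_congr rfl fun t' _ => by ring
  simp only [h]
  rw [Finset.sum_comm]
  simp only [Finset.sum_comm (s := (Finset.univ : Finset (A → Fin 2))) (t := Finset.univ)
    (f := fun a t' => pauliString α a _ * pauliString α a t' * (u _ * v t')), ← Finset.sum_mul,
    sum_pauliString_mul_pauliString]
  simp [Finset.mul_sum]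

/-- The two copies of α meet on the contracted part and cancel up to a sign. -/
lemma contractVec_pauliString (α : A → Fin 4) (p : B ⊕ C → Fin 4)
    (ψ : (A ⊕ B → Fin 2) → ℂ) (φ : (A ⊕ C → Fin 2) → ℂ) :
    contractVec ((pauliString (Sum.elim α (p ∘ Sum.inl))).mulVec ψ)
      ((pauliString (Sum.elim α (p ∘ Sum.inr))).mulVec φ) =
    Complex.I ^ (∑ q, conjSign (α q)) • (pauliString p).mulVec (contractVec ψ φ) := by
  ext s
  simp only [contractVec, Matrix.mulVec, dotProduct, sum_sumElim, pauliString_sum,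
    Sum.elim_comp_inl, Sum.elim_comp_inr, Pi.smul_apply, smul_eq_mul, mul_assoc,
    ← Finset.mul_sum]
  rw [sum_mulVec_mul_mulVec]
  congr 1
  simp only [Finset.sum_mul_sum]
  simp only [Finset.mul_sum]
  rw [Finset.sum_comm]
  refine Finset.sum_congr rfl fun b _ => ?_
  rw [Finset.sum_comm]
  exact Finset.sum_congr rfl fun c _ => Finset.sum_congr rfl fun a _ => by ring

/-- The operator `Tr_B [(1 ⊗ P) |ψ⟩⟨ψ|]`, transposed. -/
def reducedPairing (P : Op B) (ψ : (A ⊕ B → Fin 2) → ℂ) : Op A :=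
  Matrix.of fun a a' => ∑ b, ∑ b', P b b' * (star (ψ (Sum.elim a b)) * ψ (Sum.elim a' b'))

/-- With the string on B held fixed, the expectations become the Pauli coefficients of a single
operator on A, to which completeness applies. -/
lemma expectation_eq_reducedPairing (p : A ⊕ B → Fin 4) (ψ : (A ⊕ B → Fin 2) → ℂ) :
    star ψ ⬝ᵥ (pauliString p).mulVec ψ = ∑ a, ∑ a', pauliString (p ∘ Sum.inl) a a' *
      reducedPairing (pauliString (p ∘ Sum.inr)) ψ a a' := by
  simp only [expectation_eq_sum, sum_sumElim, pauliString_sum, reducedPairing, Matrix.of_apply,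
    Sum.elim_comp_inl, Sum.elim_comp_inr, Finset.mul_sum]
  refine Finset.sum_congr rfl fun a _ => ?_
  rw [Finset.sum_comm]
  refine Finset.sum_congr rfl fun a' _ => ?_
  exact Finset.sum_congr rfl fun b _ => Finset.sum_congr rfl fun b' _ => by ring

lemma sum_sum_mul_sum {ι κ μ : Type*} [Fintype ι] [Fintype κ] [Fintype μ] (f : ι → κ → ℂ)
    (g : ι → μ → ℂ) :
    ∑ x, (∑ y, f x y) * (∑ z, g x z) = ∑ y, ∑ z, ∑ x, f x y * g x z := by
  simp only [Finset.sum_mul_sum]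
  rw [Finset.sum_comm]
  exact Finset.sum_congr rfl fun _ _ => Finset.sum_comm

lemma expectation_contractVec (p : B ⊕ C → Fin 4) (ψ : (A ⊕ B → Fin 2) → ℂ)
    (φ : (A ⊕ C → Fin 2) → ℂ) :
    star (contractVec ψ φ) ⬝ᵥ (pauliString p).mulVec (contractVec ψ φ) =
      ∑ a, ∑ a', reducedPairing (pauliString (p ∘ Sum.inl)) ψ a a' *
        reducedPairing (pauliString (p ∘ Sum.inr)) φ a a' := by
  simp only [expectation_eq_sum, sum_sumElim, pauliString_sum, reducedPairing, Matrix.of_apply,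
    Sum.elim_comp_inl, Sum.elim_comp_inr, contractVec, star_sum, star_mul']
  calc _ = ∑ b, ∑ b', ∑ c, ∑ c', ∑ a, ∑ a',
        pauliString (p ∘ Sum.inl) b b' *
            (star (ψ (Sum.elim a b)) * ψ (Sum.elim a' b')) *
          (pauliString (p ∘ Sum.inr) c c' *
            (star (φ (Sum.elim a c)) * φ (Sum.elim a' c'))) := by
        simp only [Finset.sum_mul_sum]
        simp only [Finset.mul_sum]
        refine Finset.sum_congr rfl fun b _ => ?_
        rw [Finset.sum_comm]
        iterate 5 refine Finset.sum_congr rfl fun _ _ => ?_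
        ring
    _ = _ := by
        simp only [← Fintype.sum_prod_type' (α₁ := A → Fin 2) (α₂ := A → Fin 2)]
        simp only [← Fintype.sum_prod_type' (α₁ := B → Fin 2) (α₂ := B → Fin 2),
          ← Fintype.sum_prod_type' (α₁ := C → Fin 2) (α₂ := C → Fin 2)]
        exact (sum_sum_mul_sum
          (fun (x : (A → Fin 2) × (A → Fin 2)) (y : (B → Fin 2) × (B → Fin 2)) =>
            pauliString (p ∘ Sum.inl) y.1 y.2 *
              (star (ψ (Sum.elim x.1 y.1)) * ψ (Sum.elim x.2 y.2)))
          (fun (x : (A → Fin 2) × (A → Fin 2)) (z : (C → Fin 2) × (C → Fin 2)) =>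
            pauliString (p ∘ Sum.inr) z.1 z.2 *
              (star (φ (Sum.elim x.1 z.1)) * φ (Sum.elim x.2 z.2)))).symm

theorem IsStabilizerVector.contractVec {ψ : (A ⊕ B → Fin 2) → ℂ} {φ : (A ⊕ C → Fin 2) → ℂ}
    (hψ : IsStabilizerVector ψ) (hφ : IsStabilizerVector φ) :
    IsStabilizerVector (contractVec ψ φ) := by
  intro p
  by_cases h : ∃ α : A → Fin 4,
    (∃ k : ℕ, (pauliString (Sum.elim α (p ∘ Sum.inl))).mulVec ψ = Complex.I ^ k • ψ) ∧
    (∃ k : ℕ, (pauliString (Sum.elim α (p ∘ Sum.inr))).mulVec φ = Complex.I ^ k • φ)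
  · obtain ⟨α, ⟨k, hk⟩, ⟨l, hl⟩⟩ := h
    have h1 := contractVec_pauliString α p ψ φ
    have h2 : Magic.contractVec (Complex.I ^ k • ψ) (Complex.I ^ l • φ) =
        Complex.I ^ (k + l) • Magic.contractVec ψ φ := by
      ext s
      simp only [Magic.contractVec, Pi.smul_apply, smul_eq_mul, Finset.mul_sum, pow_add]
      exact Finset.sum_congr rfl fun a _ => by ring
    rw [hk, hl, h2] at h1
    set m := ∑ q, conjSign (α q)
    -- The term 3m undoes the sign i ^ m left by cancelling α.
    refine Or.inl ⟨3 * m + (k + l), ?_⟩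
    rw [pow_add, mul_smul, h1, smul_smul, ← pow_add, show 3 * m + m = 4 * m by ring, pow_mul,
      Complex.I_pow_four, one_pow, one_smul]
  · right
    -- Completeness on A writes 2 ^ |A| times the expectation in the contraction as a sum over α of
    -- signed products of expectations in ψ and φ. No α fixes both vectors, so every product has a
    -- zero factor.
    have h1 := sum_pauliString_pairing (reducedPairing (pauliString (p ∘ Sum.inl)) ψ)
      (reducedPairing (pauliString (p ∘ Sum.inr)) φ)
    rw [← expectation_contractVec, Finset.sum_eq_zero] at h1
    · exact (mul_eq_zero.1 h1.symm).resolve_left (by positivity)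
    · intro α _
      simp only [star_pauliString, mul_assoc, ← Finset.mul_sum]
      have h2 := expectation_eq_reducedPairing (Sum.elim α (p ∘ Sum.inl)) ψ
      have h3 := expectation_eq_reducedPairing (Sum.elim α (p ∘ Sum.inr)) φ
      rw [Sum.elim_comp_inl, Sum.elim_comp_inr] at h2 h3
      rw [← h2, ← h3]
      rcases hψ (Sum.elim α (p ∘ Sum.inl)) with h4 | h4
      · rcases hφ (Sum.elim α (p ∘ Sum.inr)) with h5 | h5
        · exact absurd ⟨α, h4, h5⟩ h
        · rw [h5, mul_zero, mul_zero]
      · rw [h4, zero_mul]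

end Contraction

/-! ### The maximally entangled vector -/

section MaximallyEntangled

variable {Q : Type} [Fintype Q] [DecidableEq Q]

/-- The unnormalized maximally entangled vector. -/
def maxEntangled (Q : Type) [Fintype Q] [DecidableEq Q] : (Q ⊕ Q → Fin 2) → ℂ :=
  fun s => if s ∘ Sum.inl = s ∘ Sum.inr then 1 else 0

lemma maxEntangled_sumElim (a b : Q → Fin 2) :
    maxEntangled Q (Sum.elim a b) = if a = b then 1 else 0 := rfl

lemma sum_pauliString_mul_pauliString_row (p : Q → Fin 4) (t t' : Q → Fin 2) :
    ∑ s, pauliString p t s * pauliString p t' s =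
      if t = t' then Complex.I ^ (3 * ∑ q, conjSign (p q)) else 0 := by
  have hT : ∀ a b : Q → Fin 2, pauliString p a b =
      Complex.I ^ (∑ q, conjSign (p q)) * pauliString p b a := fun a b => by
    rw [← star_pauliString, ← Matrix.conjTranspose_apply, conjTranspose_pauliString]
  have h : ∀ s, pauliString p t s * pauliString p t' s =
      Complex.I ^ (2 * ∑ q, conjSign (p q)) * (pauliString p s t * pauliString p s t') := by
    intro s
    rw [hT t, hT t']
    ring
  simp only [h, ← Finset.mul_sum, sum_pauliString_mul_pauliString]
  split_ifs
  · rw [← pow_add]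
    congr 1
    ring
  · rw [mul_zero]

/-- Under vectorization P ⊗ P' sends this vector to PP'ᵀ. For P = P' that is a phase times the
identity; otherwise the expectation is the trace of PP'ᵀ, which vanishes by orthogonality. -/
lemma isStabilizerVector_maxEntangled : IsStabilizerVector (maxEntangled Q) := by
  intro p
  have h1 : ∀ s, (pauliString p).mulVec (maxEntangled Q) s =
      ∑ a, pauliString (p ∘ Sum.inl) (s ∘ Sum.inl) a *
        pauliString (p ∘ Sum.inr) (s ∘ Sum.inr) a := by
    intro s
    simp [Matrix.mulVec, dotProduct, sum_sumElim, pauliString_sum, maxEntangled_sumElim]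
  by_cases h : p ∘ Sum.inl = p ∘ Sum.inr
  · refine Or.inl ⟨3 * ∑ q, conjSign ((p ∘ Sum.inl) q), ?_⟩
    ext s
    rw [h1, ← h, sum_pauliString_mul_pauliString_row]
    simp [maxEntangled]
  · right
    have h2 := sum_star_pauliString_mul (p ∘ Sum.inl) (p ∘ Sum.inr)
    rw [if_neg h] at h2
    simp only [dotProduct, h1, sum_sumElim]
    simp only [star_pauliString, mul_assoc, ← Finset.mul_sum] at h2
    simpa [maxEntangled_sumElim, Complex.I_ne_zero, apply_ite] using h2

end MaximallyEntangled

/-! ### The cone of unnormalized stabilizer states -/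

open scoped NNReal

section Cone

variable {Q R : Type} [Fintype Q] [DecidableEq Q] [Fintype R] [DecidableEq R]

/-- The density matrices of the pure stabilizer states. -/
def pureSTAB (Q : Type) [Fintype Q] [DecidableEq Q] : Set (Op Q) :=
  {ρ | ∃ ψ : (Q → Fin 2) → ℂ, IsPureStabilizer ψ ∧ ρ = Matrix.vecMulVec ψ (star ψ)}

/-- The unnormalized stabilizer states. -/
noncomputable def stabCone (Q : Type) [Fintype Q] [DecidableEq Q] : Submodule ℝ≥0 (Op Q) :=
  Submodule.span ℝ≥0 (pureSTAB Q)

lemma trace_eq_one_of_mem_STAB {ρ : Op Q} (h : ρ ∈ STAB Q) : ρ.trace = 1 := by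
  have hconv : Convex ℝ {X : Op Q | X.trace = 1} := by
    intro X hX Y hY a b _ _ hab
    simp only [Set.mem_ofPred_eq] at hX hY ⊢
    rw [Matrix.trace_add, Matrix.trace_smul, Matrix.trace_smul, hX, hY, ← add_smul, hab, one_smul]
  refine convexHull_min ?_ hconv h
  rintro _ ⟨ψ, hψ, rfl⟩
  rw [Set.mem_ofPred_eq, Matrix.trace_vecMulVec, dotProduct_comm]
  exact hψ.1

lemma mem_stabCone_of_mem_STAB {ρ : Op Q} (h : ρ ∈ STAB Q) : ρ ∈ stabCone Q := by
  refine convexHull_min Submodule.subset_span ?_ h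
  intro X hX Y hY a b ha hb _
  exact add_mem ((stabCone Q).smul_mem ⟨a, ha⟩ hX) ((stabCone Q).smul_mem ⟨b, hb⟩ hY)

lemma mem_STAB_of_mem_stabCone {X : Op Q} (h : X ∈ stabCone Q) (htr : X.trace = 1) :
    X ∈ STAB Q := by
  -- The convex cone hull only allows strictly positive scalars, so zero is kept apart. Its elements
  -- are positive multiples of trace-one states, and the trace then forces the multiple to be 1.
  have h1 : X = 0 ∨ X ∈ ConvexCone.hull ℝ (STAB Q) := by
    clear htr
    induction h using Submodule.span_induction with
    | mem X hX =>
      exact Or.inr (ConvexCone.subset_hull (subset_convexHull ℝ _ hX))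
    | zero => exact Or.inl rfl
    | add X Y _ _ hX hY =>
      rcases hX with rfl | hX
      · simpa using hY
      · rcases hY with rfl | hY
        · simpa using Or.inr hX
        · exact Or.inr (ConvexCone.add_mem _ hX hY)
    | smul c X _ hX =>
      rcases hX with rfl | hX
      · simp
      · rcases eq_or_ne c 0 with rfl | hc
        · simp
        · exact Or.inr (ConvexCone.smul_mem _ (c := (c : ℝ)) (by positivity) hX)
  rcases h1 with rfl | h1
  · simp at htr
  · obtain ⟨c, hc, ρ, hρ, rfl⟩ := (ConvexCone.mem_hull_of_convex (convex_convexHull ℝ _)).1 h1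
    rw [Matrix.trace_smul, trace_eq_one_of_mem_STAB hρ, Complex.real_smul, mul_one] at htr
    have hc1 : c = 1 := by exact_mod_cast htr
    subst hc1
    simpa using show ρ ∈ STAB Q from hρ

/-- Working in the cone absorbs norms: a nonzero vector is normalized, and a contraction that
vanishes is still covered. -/
lemma IsStabilizerVector.vecMulVec_mem_stabCone {ψ : (Q → Fin 2) → ℂ}
    (h : IsStabilizerVector ψ) : Matrix.vecMulVec ψ (star ψ) ∈ stabCone Q := by
  rcases eq_or_ne ψ 0 with rfl | hψ
  · simp
  obtain ⟨r, hr, hr'⟩ : ∃ r : ℝ, 0 < r ∧ star ψ ⬝ᵥ ψ = r := by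
    have := Matrix.dotProduct_star_self_pos_iff.2 hψ
    exact ⟨(star ψ ⬝ᵥ ψ).re, (Complex.pos_iff.1 this).1,
      Complex.ext rfl (Complex.pos_iff.1 this).2.symm⟩
  set c : ℝ := (√r)⁻¹ with hc
  have hc2 : c * c = r⁻¹ := by rw [hc, ← mul_inv, Real.mul_self_sqrt hr.le]
  have h1 : IsPureStabilizer ((c : ℂ) • ψ) := by
    refine (h.smul c).isPureStabilizer ?_
    rw [star_smul, smul_dotProduct, dotProduct_smul, hr', smul_smul, RCLike.star_def,
      Complex.conj_ofReal, ← Complex.ofReal_mul, hc2, smul_eq_mul, ← Complex.ofReal_mul,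
      inv_mul_cancel₀ hr.ne', Complex.ofReal_one]
  have h2 : Matrix.vecMulVec ψ (star ψ) =
      r.toNNReal • Matrix.vecMulVec ((c : ℂ) • ψ) (star ((c : ℂ) • ψ)) := by
    rw [star_smul, Matrix.smul_vecMulVec, Matrix.vecMulVec_smul, smul_smul, RCLike.star_def,
      Complex.conj_ofReal, ← Complex.ofReal_mul, hc2]
    ext s s'
    simp only [Matrix.smul_apply, NNReal.smul_def, Real.coe_toNNReal r hr.le,
      Complex.real_smul, smul_eq_mul]
    rw [← mul_assoc, ← Complex.ofReal_mul, mul_inv_cancel₀ hr.ne', Complex.ofReal_one, one_mul]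
  rw [h2]
  exact Submodule.smul_mem _ _ (Submodule.subset_span ⟨_, h1, rfl⟩)

/-- Relabelling of the qubits of an operator. -/
def relabelOp (e : Q ≃ R) : OpMap Q R where
  toFun X := Matrix.of fun s s' => X (s ∘ e) (s' ∘ e)
  map_add' _ _ := rfl
  map_smul' _ _ := rfl

lemma relabelOp_apply {Q R : Type} (e : Q ≃ R) (X : Op Q) (s s' : R → Fin 2) :
    relabelOp e X s s' = X (s ∘ e) (s' ∘ e) := rfl

lemma trace_relabelOp (e : Q ≃ R) (X : Op Q) : (relabelOp e X).trace = X.trace :=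
  Fintype.sum_equiv (e.arrowCongr (Equiv.refl _)).symm _ _ fun _ => rfl

lemma posSemidef_relabelOp {Q R : Type} (e : Q ≃ R) {X : Op Q} (h : X.PosSemidef) :
    (relabelOp e X).PosSemidef :=
  h.submatrix fun s : R → Fin 2 => s ∘ e

lemma relabelOp_mem_stabCone (e : Q ≃ R) {X : Op Q} (h : X ∈ stabCone Q) :
    relabelOp e X ∈ stabCone R := by
  induction h using Submodule.span_induction with
  | mem X hX =>
    obtain ⟨ψ, hψ, rfl⟩ := hX
    exact (hψ.isStabilizerVector.relabel e).vecMulVec_mem_stabCone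
  | zero => simp
  | add X Y _ _ hX hY => exact map_add (relabelOp e) X Y ▸ add_mem hX hY
  | smul c X _ hX => exact (stabCone R).smul_mem c hX

lemma relabelOp_mem_STAB (e : Q ≃ R) {X : Op Q} (h : X ∈ STAB Q) : relabelOp e X ∈ STAB R :=
  mem_STAB_of_mem_stabCone (relabelOp_mem_stabCone e (mem_stabCone_of_mem_STAB h))
    (by rw [trace_relabelOp, trace_eq_one_of_mem_STAB h])

lemma maxEntangled_mem_STAB :
    ((dim Q : ℕ) : ℂ)⁻¹ • Matrix.vecMulVec (maxEntangled Q) (star (maxEntangled Q)) ∈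
      STAB (Q ⊕ Q) := by
  refine mem_STAB_of_mem_stabCone ?_ ?_
  · have := (stabCone (Q ⊕ Q)).smul_mem ((dim Q : ℕ) : ℝ≥0)⁻¹
      (isStabilizerVector_maxEntangled (Q := Q)).vecMulVec_mem_stabCone
    convert this using 1
    ext s s'
    simp [NNReal.smul_def]
  · have hd : ((dim Q : ℕ) : ℂ) ≠ 0 := by simp [dim]
    rw [Matrix.trace_smul, Matrix.trace_vecMulVec, smul_eq_mul, inv_mul_eq_one₀ hd]
    simp [dotProduct, sum_sumElim, maxEntangled_sumElim, dim, apply_ite]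

end Cone

/-! ### Contraction of operators -/

section ContractOp

variable {A B C : Type} [Fintype A] [DecidableEq A] [Fintype B] [DecidableEq B]
  [Fintype C] [DecidableEq C]

/-- The contraction of two operators over the common part `A`. -/
def contractOp {A B C : Type} [Fintype A] [DecidableEq A] (X : Op (A ⊕ B)) (Y : Op (A ⊕ C)) : Op (B ⊕ C) :=
  Matrix.of fun s s' => ∑ a, ∑ a',
    X (Sum.elim a (s ∘ Sum.inl)) (Sum.elim a' (s' ∘ Sum.inl)) *
      Y (Sum.elim a (s ∘ Sum.inr)) (Sum.elim a' (s' ∘ Sum.inr))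

/-- Rows pair with rows and columns with columns, so pure operators contract to pure operators. -/
lemma contractOp_vecMulVec {B C : Type} (ψ : (A ⊕ B → Fin 2) → ℂ) (φ : (A ⊕ C → Fin 2) → ℂ) :
    contractOp (Matrix.vecMulVec ψ (star ψ)) (Matrix.vecMulVec φ (star φ)) =
      Matrix.vecMulVec (contractVec ψ φ) (star (contractVec ψ φ)) := by
  ext s s'
  simp only [contractOp, contractVec, Matrix.of_apply, Matrix.vecMulVec_apply, Pi.star_apply,
    star_sum, star_mul', Finset.sum_mul_sum]
  exact Finset.sum_congr rfl fun a _ => Finset.sum_congr rfl fun a' _ => by ring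

/-- By bilinearity it suffices to contract generators, which are pure stabilizer states. -/
lemma contractOp_mem_stabCone {X : Op (A ⊕ B)} {Y : Op (A ⊕ C)} (hX : X ∈ stabCone (A ⊕ B))
    (hY : Y ∈ stabCone (A ⊕ C)) : contractOp X Y ∈ stabCone (B ⊕ C) := by
  induction hX using Submodule.span_induction with
  | mem X hX =>
    obtain ⟨ψ, hψ, rfl⟩ := hX
    induction hY using Submodule.span_induction with
    | mem Y hY =>
      obtain ⟨φ, hφ, rfl⟩ := hY
      rw [contractOp_vecMulVec]
      exact (hψ.isStabilizerVector.contractVec hφ.isStabilizerVector).vecMulVec_mem_stabCone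
    | zero =>
      convert zero_mem (stabCone (B ⊕ C))
      ext s s'
      simp [contractOp]
    | add Y Z _ _ hY hZ =>
      convert add_mem hY hZ
      ext s s'
      simp [contractOp, mul_add, Finset.sum_add_distrib]
    | smul c Y _ hY =>
      convert (stabCone (B ⊕ C)).smul_mem c hY
      ext s s'
      simp [contractOp, Finset.smul_sum]
  | zero =>
    convert zero_mem (stabCone (B ⊕ C))
    ext s s'
    simp [contractOp]
  | add X Z _ _ hX hZ =>
    convert add_mem hX hZ
    ext s s'
    simp [contractOp, add_mul, Finset.sum_add_distrib]
  | smul c X _ hX =>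
    convert (stabCone (B ⊕ C)).smul_mem c hX
    ext s s'
    simp [contractOp, Finset.smul_sum]

end ContractOp

/-! ### CSPOs and their Choi matrices -/

section ChoiCriterion

variable {Q Q' : Type} [Fintype Q] [DecidableEq Q] [Fintype Q'] [DecidableEq Q']

lemma block_apply {Q R : Type} (r r' : R → Fin 2) (X : Op (Q ⊕ R)) (q q' : Q → Fin 2) :
    block r r' X q q' = X (Sum.elim q r) (Sum.elim q' r') := rfl

lemma apply_eq_sum_choi {Q' : Type} (E : OpMap Q Q') (X : Op Q) (t t' : Q' → Fin 2) :
    E X t t' = ∑ a, ∑ a', choi E (Sum.elim a t) (Sum.elim a' t') * X a a' := by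
  conv_lhs => rw [Matrix.matrix_eq_sum_single X]
  simp only [map_sum, Matrix.sum_apply]
  refine Finset.sum_congr rfl fun a _ => Finset.sum_congr rfl fun a' _ => ?_
  have h : Matrix.single a a' (X a a') = X a a' • Matrix.single a a' (1 : ℂ) := by simp
  rw [h, map_smul, Matrix.smul_apply, smul_eq_mul, mul_comm]
  rfl

lemma tensorId_eq_contractOp {Q' : Type} (R : Type) [Fintype R] [DecidableEq R] (E : OpMap Q Q')
    (X : Op (Q ⊕ R)) : tensorId R E X = contractOp (choi E) X := by
  ext s s'
  exact apply_eq_sum_choi E _ _ _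

lemma trace_tensorId (R : Type) [Fintype R] [DecidableEq R] {E : OpMap Q Q'}
    (hE : ∀ X : Op Q, (E X).trace = X.trace) (X : Op (Q ⊕ R)) :
    (tensorId R E X).trace = X.trace := by
  simp only [Matrix.trace, Matrix.diag, sum_sumElim]
  rw [Finset.sum_comm, Finset.sum_comm (s := (Finset.univ : Finset (Q → Fin 2)))]
  exact Finset.sum_congr rfl fun r _ => hE (block r r X)

/-- A channel whose Choi matrix is an unnormalized stabilizer state is a CSPO. -/
theorem isCSPO_of_choi_mem_stabCone {E : OpMap Q Q'} (hE : IsCPTP E)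
    (h : choi E ∈ stabCone (Q ⊕ Q')) : IsCSPO E where
  isCPTP := hE
  mem_STAB R _ _ ρ hρ := by
    refine mem_STAB_of_mem_stabCone ?_ ?_
    · rw [tensorId_eq_contractOp]
      exact contractOp_mem_stabCone h (mem_stabCone_of_mem_STAB hρ)
    · rw [trace_tensorId R hE.tracePreserving, trace_eq_one_of_mem_STAB hρ]

/-- The normalized Choi matrix of a CSPO is a stabilizer state. -/
theorem IsCSPO.choi_mem_STAB {E : OpMap Q Q'} (hE : IsCSPO E) :
    ((dim Q : ℕ) : ℂ)⁻¹ • choi E ∈ STAB (Q ⊕ Q') := by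
  -- The map acts on the first half of the entangled pair, so its output comes before the reference;
  -- the Choi matrix has the opposite order.
  have h := relabelOp_mem_STAB (Equiv.sumComm Q' Q) (hE.mem_STAB Q _ maxEntangled_mem_STAB)
  convert h using 1
  rw [map_smul, map_smul]
  congr 1
  have hb : ∀ r r' : Q → Fin 2, block r r'
      (Matrix.vecMulVec (maxEntangled Q) (star (maxEntangled Q))) = Matrix.single r r' 1 := by
    intro r r'
    ext a a'
    simp only [block_apply, Matrix.vecMulVec_apply, Pi.star_apply, maxEntangled_sumElim, Matrix.single_apply]
    by_cases h1 : r = a <;> by_cases h2 : r' = a' <;> simp [h1, h2, eq_comm]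
  ext s s'
  exact congrFun (congrFun (congrArg E (hb (s ∘ Sum.inl) (s' ∘ Sum.inl))).symm _) _

lemma mem_stabCone_of_inv_smul_mem_STAB {d : ℕ} (hd : d ≠ 0) {X : Op Q}
    (h : (d : ℂ)⁻¹ • X ∈ STAB Q) : X ∈ stabCone Q := by
  have h1 := nsmul_mem (mem_stabCone_of_mem_STAB h) d
  rwa [← Nat.cast_smul_eq_nsmul ℂ, smul_smul, mul_inv_cancel₀ (Nat.cast_ne_zero.2 hd),
    one_smul] at h1

lemma dim_ne_zero (Q : Type) [Fintype Q] [DecidableEq Q] : dim Q ≠ 0 := by simp [dim]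

lemma dim_sum (Q R : Type) [Fintype Q] [DecidableEq Q] [Fintype R] [DecidableEq R] :
    dim (Q ⊕ R) = dim Q * dim R := by
  simp [dim, pow_add]

/-- Relabelling qubits is a CSPO. -/
lemma isCSPO_relabelOp (e : Q ≃ Q') : IsCSPO (relabelOp e) := by
  have h : ∀ (R : Type) [Fintype R] [DecidableEq R] (X : Op (Q ⊕ R)),
      tensorId R (relabelOp e) X = relabelOp (e.sumCongr (Equiv.refl R)) X := by
    intro R _ _ X
    ext s s'
    refine congrArg₂ X ?_ ?_ <;> ext (x | x) <;> rfl
  refine ⟨⟨fun R _ _ X hX => ?_, trace_relabelOp e⟩, fun R _ _ ρ hρ => ?_⟩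
  · rw [h]
    exact posSemidef_relabelOp _ hX
  · rw [h]
    exact relabelOp_mem_STAB _ hρ

end ChoiCriterion

/-! ### Choi matrices of supermaps -/

section SuperChoi

variable {A₀ A₁ B₀ B₁ R₀ R₁ : Type} [Fintype A₀] [DecidableEq A₀] [Fintype A₁] [DecidableEq A₁]
  [Fintype B₀] [DecidableEq B₀] [Fintype B₁] [DecidableEq B₁]
  [Fintype R₀] [DecidableEq R₀] [Fintype R₁] [DecidableEq R₁]

lemma eq_sum_elementaryMap (N : OpMap A₀ A₁) :
    N = ∑ a, ∑ a', choi N a a' • elementaryMap a a' := by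
  refine LinearMap.ext fun X => Matrix.ext fun t t' => ?_
  rw [apply_eq_sum_choi]
  simp only [LinearMap.sum_apply, LinearMap.smul_apply, Matrix.sum_apply, Matrix.smul_apply,
    sum_sumElim, elementaryMap, LinearMap.coe_mk, AddHom.coe_mk, Sum.elim_comp_inl,
    Sum.elim_comp_inr, Matrix.single_apply, smul_eq_mul, mul_ite, mul_one, mul_zero, ite_and]
  refine Finset.sum_congr rfl fun a _ => ?_
  rw [Finset.sum_comm]
  refine Finset.sum_congr rfl fun a' _ => ?_
  simp

lemma choi_superMap_apply {B₁ : Type} (Θ : SuperMap A₀ A₁ B₀ B₁) (N : OpMap A₀ A₁)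
    (u u' : B₀ ⊕ B₁ → Fin 2) :
    choi (Θ N) u u' =
      ∑ a, ∑ a', superChoi Θ (Sum.elim a u) (Sum.elim a' u') * choi N a a' := by
  conv_lhs => rw [eq_sum_elementaryMap N]
  simp only [map_sum, map_smul, choi, Matrix.of_apply, LinearMap.sum_apply, LinearMap.smul_apply,
    Matrix.sum_apply, Matrix.smul_apply, smul_eq_mul]
  exact Finset.sum_congr rfl fun a _ => Finset.sum_congr rfl fun a' _ => mul_comm _ _

lemma block_single {B₀ R₀ : Type} [Fintype B₀] [Fintype R₀] (r r' : R₀ → Fin 2) (s s' : B₀ ⊕ R₀ → Fin 2) :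
    block r r' (Matrix.single s s' (1 : ℂ)) =
      if r = s ∘ Sum.inr then if r' = s' ∘ Sum.inr then
        Matrix.single (s ∘ Sum.inl) (s' ∘ Sum.inl) 1 else 0 else 0 := by
  have h : ∀ (s : B₀ ⊕ R₀ → Fin 2) (b r), s = Sum.elim b r ↔ r = s ∘ Sum.inr ∧ s ∘ Sum.inl = b := by
    intro s b r
    constructor
    · rintro rfl
      simp
    · rintro ⟨rfl, rfl⟩
      simp
  ext b b'
  rw [block_apply, Matrix.single_apply]
  simp only [h]
  split_ifs <;> simp_all

/-- A matrix unit on B₀R₀ has a single nonzero block, so only one slice survives. -/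
lemma choi_applyPart_apply {A₀ A₁ B₁ R₁ : Type} (Θ : SuperMap A₀ A₁ B₀ B₁) (N : OpMap (A₀ ⊕ R₀) (A₁ ⊕ R₁))
    (s s' : (B₀ ⊕ R₀) ⊕ (B₁ ⊕ R₁) → Fin 2) :
    choi (applyPart Θ N) s s' =
      choi (Θ (slice N (s ∘ Sum.inl ∘ Sum.inr) (s' ∘ Sum.inl ∘ Sum.inr)
        (s ∘ Sum.inr ∘ Sum.inr) (s' ∘ Sum.inr ∘ Sum.inr)))
        (Sum.elim (s ∘ Sum.inl ∘ Sum.inl) (s ∘ Sum.inr ∘ Sum.inl))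
        (Sum.elim (s' ∘ Sum.inl ∘ Sum.inl) (s' ∘ Sum.inr ∘ Sum.inl)) := by
  change ∑ r, ∑ r', Θ (slice N r r' _ _) (block r r' (Matrix.single _ _ 1)) _ _ = _
  simp only [block_single]
  rw [Finset.sum_eq_single (s ∘ Sum.inl ∘ Sum.inr), Finset.sum_eq_single (s' ∘ Sum.inl ∘ Sum.inr),
    if_pos (by rfl), if_pos (by rfl)]
  · rfl
  · intro r' _ hr'
    rw [if_pos (by rfl), if_neg (by exact hr'), map_zero, Matrix.zero_apply]
  · simp
  · intro r _ hr
    refine Finset.sum_eq_zero fun r' _ => ?_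
    rw [if_neg (by exact hr), map_zero, Matrix.zero_apply]
  · simp

lemma choi_slice {A₁ R₁ : Type} (N : OpMap (A₀ ⊕ R₀) (A₁ ⊕ R₁)) (r r' : R₀ → Fin 2) (t t' : R₁ → Fin 2)
    (a a' : A₀ ⊕ A₁ → Fin 2) :
    choi (slice N r r' t t') a a' =
      relabelOp (Equiv.sumSumSumComm A₀ R₀ A₁ R₁) (choi N)
        (Sum.elim a (Sum.elim r t)) (Sum.elim a' (Sum.elim r' t')) := by
  have h : ∀ (a : A₀ ⊕ A₁ → Fin 2) (r : R₀ → Fin 2) (t : R₁ → Fin 2),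
      Sum.elim a (Sum.elim r t) ∘ Equiv.sumSumSumComm A₀ R₀ A₁ R₁ =
        Sum.elim (Sum.elim (a ∘ Sum.inl) r) (Sum.elim (a ∘ Sum.inr) t) := by
    intro a r t
    ext ((x | x) | (x | x)) <;> rfl
  have h2 : tensor (Matrix.single (a ∘ Sum.inl) (a' ∘ Sum.inl) (1 : ℂ)) (Matrix.single r r' 1) =
      Matrix.single (Sum.elim (a ∘ Sum.inl) r) (Sum.elim (a' ∘ Sum.inl) r') 1 := by
    have h3 : ∀ (u : A₀ → Fin 2) (r : R₀ → Fin 2) (s : A₀ ⊕ R₀ → Fin 2),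
        Sum.elim u r = s ↔ u = s ∘ Sum.inl ∧ r = s ∘ Sum.inr := by
      intro u r s
      constructor
      · rintro rfl
        simp
      · rintro ⟨rfl, rfl⟩
        simp
    ext s s'
    simp only [tensor, Matrix.of_apply, Matrix.single_apply, h3]
    split_ifs <;> simp_all
  rw [relabelOp_apply, h, h]
  change N (tensor _ _) _ _ = _
  rw [h2]
  rfl

/-- The Choi matrix of `(Θ ⊗ 1)[N]` is the contraction of the Choi matrices of `Θ` and `N`. -/
lemma choi_applyPart {B₁ R₁ : Type} (Θ : SuperMap A₀ A₁ B₀ B₁) (N : OpMap (A₀ ⊕ R₀) (A₁ ⊕ R₁)) :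
    choi (applyPart Θ N) = relabelOp (Equiv.sumSumSumComm B₀ B₁ R₀ R₁)
      (contractOp (superChoi Θ) (relabelOp (Equiv.sumSumSumComm A₀ R₀ A₁ R₁) (choi N))) := by
  ext s s'
  rw [choi_applyPart_apply, choi_superMap_apply, relabelOp_apply]
  simp only [choi_slice, contractOp, Matrix.of_apply]
  have h1 : ∀ s : (B₀ ⊕ R₀) ⊕ (B₁ ⊕ R₁) → Fin 2,
      (s ∘ Equiv.sumSumSumComm B₀ B₁ R₀ R₁) ∘ Sum.inl =
        Sum.elim (s ∘ Sum.inl ∘ Sum.inl) (s ∘ Sum.inr ∘ Sum.inl) := by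
    intro s
    ext (x | x) <;> rfl
  have h2 : ∀ s : (B₀ ⊕ R₀) ⊕ (B₁ ⊕ R₁) → Fin 2,
      (s ∘ Equiv.sumSumSumComm B₀ B₁ R₀ R₁) ∘ Sum.inr =
        Sum.elim (s ∘ Sum.inl ∘ Sum.inr) (s ∘ Sum.inr ∘ Sum.inr) := by
    intro s
    ext (x | x) <;> rfl
  simp only [h1, h2]

/-- The swap contains every elementary map as a slice, so Θ ⊗ 1 applied to it records all the values
that make up the Choi matrix of Θ. -/
lemma slice_swap {A₀ : Type} (r r' : A₁ → Fin 2) (t t' : A₀ → Fin 2) :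
    slice (relabelOp (Equiv.sumComm A₀ A₁)) r r' t t' =
      elementaryMap (Sum.elim t r) (Sum.elim t' r') :=
  LinearMap.ext fun _ => Matrix.ext fun _ _ => rfl

/-- The relabelling that identifies the Choi matrix of a supermap with that of the map into which
it turns the swap. -/
def swapEquiv (A₀ A₁ B₀ B₁ : Type) : (B₀ ⊕ A₁) ⊕ (B₁ ⊕ A₀) ≃ (A₀ ⊕ A₁) ⊕ (B₀ ⊕ B₁) :=
  (Equiv.sumSumSumComm B₀ A₁ B₁ A₀).trans ((Equiv.sumComm _ _).trans
    ((Equiv.sumComm A₁ A₀).sumCongr (Equiv.refl _)))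

/-- The Choi matrix of `Θ` is that of `(Θ ⊗ 1)[N]`, where `N` is the swap. -/
lemma superChoi_eq_choi_swap {A₀ B₁ : Type} (Θ : SuperMap A₀ A₁ B₀ B₁) :
    superChoi Θ = relabelOp (swapEquiv A₀ A₁ B₀ B₁)
      (choi (applyPart Θ (relabelOp (Equiv.sumComm A₀ A₁)))) := by
  ext s s'
  rw [relabelOp_apply, choi_applyPart_apply, slice_swap]
  have h1 : ∀ s : (A₀ ⊕ A₁) ⊕ (B₀ ⊕ B₁) → Fin 2,
      Sum.elim ((s ∘ swapEquiv A₀ A₁ B₀ B₁) ∘ Sum.inr ∘ Sum.inr)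
        ((s ∘ swapEquiv A₀ A₁ B₀ B₁) ∘ Sum.inl ∘ Sum.inr) = s ∘ Sum.inl := by
    intro s
    ext (x | x) <;> rfl
  have h2 : ∀ s : (A₀ ⊕ A₁) ⊕ (B₀ ⊕ B₁) → Fin 2,
      Sum.elim ((s ∘ swapEquiv A₀ A₁ B₀ B₁) ∘ Sum.inl ∘ Sum.inl)
        ((s ∘ swapEquiv A₀ A₁ B₀ B₁) ∘ Sum.inr ∘ Sum.inl) = s ∘ Sum.inr := by
    intro s
    ext (x | x) <;> rfl
  rw [h1, h1, h2, h2]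
  rfl

end SuperChoi

end Magic

/-! ### The characterization of completely CSPO preserving superchannels -/

theorem mainTheorem1 (A₀ A₁ B₀ B₁ : Type)
    [Fintype A₀] [DecidableEq A₀] [Fintype A₁] [DecidableEq A₁]
    [Fintype B₀] [DecidableEq B₀] [Fintype B₁] [DecidableEq B₁]
    (Θ : Magic.SuperMap A₀ A₁ B₀ B₁) (hΘ : Magic.IsSuperchannel Θ) :
    Magic.IsCompletelyCSPOPreserving Θ ↔
      ((Magic.dim A₁ * Magic.dim B₀ : ℕ) : ℂ)⁻¹ • Magic.superChoi Θ ∈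
        Magic.STAB ((A₀ ⊕ A₁) ⊕ (B₀ ⊕ B₁)) := by
  open Magic in
  constructor
  · intro h
    -- With R₀ = A₁ and R₁ = A₀ the swap is an admissible input. The resulting map has input B₀A₁,
    -- which accounts for the normalization |A₁B₀|.
    have h1 := (h A₁ A₀ _ (isCSPO_relabelOp (Equiv.sumComm A₀ A₁))).choi_mem_STAB
    rw [dim_sum, mul_comm] at h1
    rw [superChoi_eq_choi_swap, ← map_smul]
    exact relabelOp_mem_STAB _ h1
  · intro h R₀ R₁ _ _ _ _ N hN
    refine isCSPO_of_choi_mem_stabCone (hΘ R₀ R₁ N hN.isCPTP) ?_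
    rw [choi_applyPart]
    refine relabelOp_mem_stabCone _ (contractOp_mem_stabCone
      (mem_stabCone_of_inv_smul_mem_STAB (mul_ne_zero (dim_ne_zero _) (dim_ne_zero _)) h)
      (relabelOp_mem_stabCone _ (mem_stabCone_of_inv_smul_mem_STAB (dim_ne_zero _)
        hN.choi_mem_STAB)))
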